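/- Let $X$ be a connected, locally connected, paracompact Hausdorff space and let $\pi\colon E\to X$ be a locally trivial real vector bundle of finite rank. Let $\mathrm{Gau}(E)$ be the group of all homeomorphisms $f\colon E\to E$ with $\pi\circ f=\pi$ that restrict to a linear isomorphism on each fibre, with the subspace topology of the compact-open topology on the set of continuous maps $E\to E$, and let $\mathrm{Gau}_0(E)$ be the path component of the identity in $\mathrm{Gau}(E)$, which is a normal subgroup. Let $\mathcal{Q}(E)$ be the space of non-degenerate quadratic forms on $E$, that is, of continuous functions $q\colon E\to\mathbb{R}$ whose restriction to each fibre $E_x$ is a non-degenerate quadratic form, with the subspace topology of the compact-open topology. The group $\mathrm{Gau}(E)$ acts on $\mathcal{Q}(E)$ from the right by $(fq)(v)=q(f(v))$. Then for every $q\in\mathcal{Q}(E)$ with $\mathrm{Gau}(E)$-orbit $O$, the cardinality of the set of path components of $\mathcal{Q}(E)$ that meet $O$ is at most the cardinality of the group $\mathrm{Gau}(E)/\mathrm{Gau}_0(E)$. The same bound holds for the cardinality of the set of path components of $O$ as a subspace of $\mathcal{Q}(E)$. -/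

import Mathlib

noncomputable section

namespace GaugeSylvester

open Bundle

universe u v w

section
variable {X : Type u} (F : Type v) (E : X → Type w)
  [TopologicalSpace (TotalSpace F E)]
  [∀ x, AddCommGroup (E x)] [∀ x, Module ℝ (E x)]

/-- The gauge group `Gau(E)`: the group (under composition) of all homeomorphisms of the total
space of `E` that cover the identity of the base and restrict to a linear isomorphism on every
fibre. -/
def Gau : Subgroup (TotalSpace F E ≃ₜ TotalSpace F E) where
  carrier := {φ | ∀ x : X, ∃ A : E x ≃ₗ[ℝ] E x, ∀ v : E x,
    φ (⟨x, v⟩ : TotalSpace F E) = ⟨x, A v⟩}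
  one_mem' := fun x => ⟨LinearEquiv.refl ℝ (E x), fun _ => rfl⟩
  mul_mem' := by
    intro φ ψ hφ hψ x
    obtain ⟨A, hA⟩ := hφ x
    obtain ⟨B, hB⟩ := hψ x
    exact ⟨B.trans A, fun v => by
      rw [Homeomorph.mul_apply, hB, hA, LinearEquiv.trans_apply]⟩
  inv_mem' := by
    intro φ hφ x
    obtain ⟨A, hA⟩ := hφ x
    refine ⟨A.symm, fun v => ?_⟩
    rw [Homeomorph.inv_apply, Homeomorph.symm_apply_eq, hA, LinearEquiv.apply_symm_apply]

/-- A gauge transformation, regarded as a continuous map of the total space into itself. -/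
def Gau.toMap (φ : Gau F E) : C(TotalSpace F E, TotalSpace F E) :=
  ⟨φ.1, φ.1.continuous⟩

/-- The topology of `Gau(E)`: the subspace topology from the space of continuous self-maps of the
total space with the compact-open topology. -/
instance Gau.instTopologicalSpace : TopologicalSpace (Gau F E) :=
  TopologicalSpace.induced (Gau.toMap F E) ContinuousMap.compactOpen

theorem Gau.continuous_toMap : Continuous (Gau.toMap F E) :=
  continuous_induced_dom

theorem Gau.continuous_mul_left (φ : Gau F E) : Continuous fun ψ : Gau F E => φ * ψ :=
  continuous_induced_rng.2
    ((ContinuousMap.continuous_postcomp (Gau.toMap F E φ)).comp (Gau.continuous_toMap F E))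

theorem Gau.continuous_mul_right (φ : Gau F E) : Continuous fun ψ : Gau F E => ψ * φ :=
  continuous_induced_rng.2
    ((ContinuousMap.continuous_precomp (Gau.toMap F E φ)).comp (Gau.continuous_toMap F E))

/-- The subgroup `Gau₀(E)`: the path component of the identity in `Gau(E)`. -/
def GauZero : Subgroup (Gau F E) where
  carrier := pathComponent (1 : Gau F E)
  one_mem' := Joined.refl _
  mul_mem' := by
    intro φ ψ (hφ : Joined 1 φ) (hψ : Joined 1 ψ)
    have h := hφ.map (Gau.continuous_mul_right F E ψ)
    rw [one_mul] at h
    exact hψ.trans h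
  inv_mem' := by
    intro φ (hφ : Joined 1 φ)
    have h := hφ.map (Gau.continuous_mul_left F E φ⁻¹)
    rw [mul_one, inv_mul_cancel] at h
    exact h.symm

/-- `Gau₀(E)` is normal, so that `Gau(E) ⧸ Gau₀(E)` is a group. -/
instance GauZero.instNormal : (GauZero F E).Normal where
  conj_mem := by
    intro φ (hφ : Joined 1 φ) ψ
    have h := (hφ.map (Gau.continuous_mul_left F E ψ)).map (Gau.continuous_mul_right F E ψ⁻¹)
    rw [mul_one, mul_inv_cancel] at h
    exact h

/-- The space of non-degenerate quadratic forms on `E`: the continuous real functions on the total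
space that restrict to a non-degenerate quadratic form on every fibre. As a subtype of the space of
continuous functions, it carries the subspace topology of the compact-open topology. -/
def QuadNondeg : Type (max u w) :=
  {q : C(TotalSpace F E, ℝ) // ∀ x : X, ∃ Q : QuadraticForm ℝ (E x),
    Q.Nondegenerate ∧ ∀ v : E x, q (⟨x, v⟩ : TotalSpace F E) = Q v}

instance QuadNondeg.instTopologicalSpace : TopologicalSpace (QuadNondeg F E) :=
  inferInstanceAs (TopologicalSpace {q : C(TotalSpace F E, ℝ) //
    ∀ x : X, ∃ Q : QuadraticForm ℝ (E x),
      Q.Nondegenerate ∧ ∀ v : E x, q (⟨x, v⟩ : TotalSpace F E) = Q v})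

variable {F E} in
/-- The pullback `v ↦ q (f v)` of a non-degenerate quadratic form `q` by `f ∈ Gau(E)`. -/
def QuadNondeg.pull (q : QuadNondeg F E) (f : Gau F E) : QuadNondeg F E :=
  ⟨q.1.comp (Gau.toMap F E f), by
    intro x
    obtain ⟨Q, hQ, hq⟩ := q.2 x
    obtain ⟨A, hA⟩ := f.2 x
    refine ⟨Q.comp A.toLinearMap, ?_, fun v => ?_⟩
    · rw [QuadraticMap.nondegenerate_iff_radical_eq_bot] at hQ ⊢
      rw [eq_bot_iff]
      intro m hm
      rw [QuadraticMap.mem_radical_iff'] at hm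
      have hAm : A m ∈ Q.radical := by
        rw [QuadraticMap.mem_radical_iff']
        refine ⟨hm.1, fun n => ?_⟩
        have h := hm.2 (A.symm n)
        rw [QuadraticMap.comp_apply, QuadraticMap.comp_apply, map_add] at h
        simpa using h
      rw [hQ, Submodule.mem_bot] at hAm
      rw [Submodule.mem_bot]
      exact A.injective (hAm.trans (map_zero A).symm)
    · have h : Gau.toMap F E f (⟨x, v⟩ : TotalSpace F E) = ⟨x, A v⟩ := hA v
      rw [ContinuousMap.comp_apply, h, hq]
      rfl⟩

/-- The natural right action `(f q)(v) = q (f v)` of `Gau(E)` on non-degenerate quadratic forms,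
written as an action of the opposite group. -/
instance QuadNondeg.instMulAction : MulAction (Gau F E)ᵐᵒᵖ (QuadNondeg F E) where
  smul f q := q.pull f.unop
  one_smul _ := rfl
  mul_smul _ _ _ := rfl

/-- The `Gau(E)`-orbit of a non-degenerate quadratic form. -/
abbrev gauOrbit (q : QuadNondeg F E) : Set (QuadNondeg F E) :=
  MulAction.orbit (Gau F E)ᵐᵒᵖ q

end

end GaugeSylvester

end

namespace GaugeSylvester

open Bundle

section
variable {X : Type*} {F : Type*} {E : X → Type*} [TopologicalSpace (TotalSpace F E)]
  [∀ x, AddCommGroup (E x)] [∀ x, Module ℝ (E x)]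

/-- The orbit map `f ↦ f q` of a quadratic form is continuous for the compact-open topologies. -/
theorem QuadNondeg.continuous_pull (q : QuadNondeg F E) :
    Continuous fun f : Gau F E => q.pull f :=
  Continuous.subtype_mk
    ((ContinuousMap.continuous_postcomp q.1).comp (Gau.continuous_toMap F E)) _

/-- The orbit map of `q`, with values in the orbit. -/
def orbitMap (q : QuadNondeg F E) (f : Gau F E) : gauOrbit F E q :=
  ⟨q.pull f, MulOpposite.op f, rfl⟩

theorem continuous_orbitMap (q : QuadNondeg F E) : Continuous (orbitMap q) :=
  q.continuous_pull.subtype_mk _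

theorem orbitMap_surjective (q : QuadNondeg F E) : Function.Surjective (orbitMap q) := by
  rintro ⟨_, f, rfl⟩
  exact ⟨f.unop, rfl⟩

/-- Gauge transformations in the same coset of `Gau₀(E)` are joined by a path in `Gau(E)`. -/
theorem Gau.joined_of_inv_mul_mem {f g : Gau F E} (h : f⁻¹ * g ∈ GauZero F E) : Joined f g := by
  -- Left translation by `f` carries a path from `1` to `f⁻¹ * g` to a path from `f` to `g`.
  have h' : Joined (f * 1) (f * (f⁻¹ * g)) :=
    Joined.map (show Joined 1 (f⁻¹ * g) from h) (Gau.continuous_mul_left F E f)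
  rwa [mul_one, mul_inv_cancel_left] at h'

/-- The map from `Gau(E) ⧸ Gau₀(E)` to the path components of the orbit of `q` that is induced by
the orbit map. -/
def quotientToComponents (q : QuadNondeg F E) :
    Gau F E ⧸ GauZero F E → ZerothHomotopy (gauOrbit F E q) :=
  Quotient.lift (fun f => ZerothHomotopy.mk (orbitMap q f)) fun _ _ h =>
    Quotient.sound
      ((Gau.joined_of_inv_mul_mem (QuotientGroup.leftRel_apply.1 h)).map (continuous_orbitMap q))

theorem quotientToComponents_surjective (q : QuadNondeg F E) :
    Function.Surjective (quotientToComponents q) := by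
  intro c
  obtain ⟨p, rfl⟩ := Quotient.exists_rep c
  obtain ⟨f, rfl⟩ := orbitMap_surjective q p
  exact ⟨(f : Gau F E ⧸ GauZero F E), rfl⟩

/-- The map sending a path component of the orbit of `q` to the path component of the space of
non-degenerate quadratic forms that contains it. -/
def componentsToImage (q : QuadNondeg F E) (c : ZerothHomotopy (gauOrbit F E q)) :
    (ZerothHomotopy.mk '' gauOrbit F E q : Set (ZerothHomotopy (QuadNondeg F E))) :=
  -- A path inside the orbit is also a path in the ambient space. The converse can fail, so this map
  -- need not be injective.
  ⟨Quotient.lift (fun p : gauOrbit F E q => ZerothHomotopy.mk p.1)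
      (fun _ _ h => Quotient.sound (Joined.map h continuous_subtype_val)) c,
    Quotient.inductionOn c fun p => ⟨p.1, p.2, rfl⟩⟩

theorem componentsToImage_surjective (q : QuadNondeg F E) :
    Function.Surjective (componentsToImage q) := by
  rintro ⟨_, p, hp, rfl⟩
  exact ⟨ZerothHomotopy.mk ⟨p, hp⟩, rfl⟩

end

end GaugeSylvester

/-- The number of path components of the space of non-degenerate quadratic forms on `E` that occur
in the `Gau(E)`-orbit of `q` is at most the cardinality of `Gau(E) / Gau₀(E)`; the same bound holds
for the path components of the orbit as a topological space of its own. -/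
theorem corollary3p16 {X : Type*} [TopologicalSpace X] [T2Space X] [ParacompactSpace X]
    [ConnectedSpace X] [LocallyConnectedSpace X]
    (F : Type*) [NormedAddCommGroup F] [NormedSpace ℝ F] [FiniteDimensional ℝ F]
    (E : X → Type*) [TopologicalSpace (Bundle.TotalSpace F E)] [∀ x, TopologicalSpace (E x)]
    [∀ x, AddCommGroup (E x)] [∀ x, Module ℝ (E x)]
    [FiberBundle F E] [VectorBundle ℝ F E]
    (q : GaugeSylvester.QuadNondeg F E) :
    Cardinal.mk (ZerothHomotopy.mk '' GaugeSylvester.gauOrbit F E q :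
        Set (ZerothHomotopy (GaugeSylvester.QuadNondeg F E)))
      ≤ Cardinal.mk (GaugeSylvester.Gau F E ⧸ GaugeSylvester.GauZero F E) ∧
    Cardinal.mk (ZerothHomotopy (GaugeSylvester.gauOrbit F E q))
      ≤ Cardinal.mk (GaugeSylvester.Gau F E ⧸ GaugeSylvester.GauZero F E) := by
  -- The first bound factors through the components of the orbit itself.
  exact ⟨Cardinal.mk_le_of_surjective
      ((GaugeSylvester.componentsToImage_surjective q).comp
        (GaugeSylvester.quotientToComponents_surjective q)),
    Cardinal.mk_le_of_surjective (GaugeSylvester.quotientToComponents_surjective q)⟩
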